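/- **Setting.** Strings over an alphabet are structures with universe $U(B)=\{1,\dots,n\}$, the order $<$, and unary predicates $R_a$ for the letters $a$. For a formula $\psi(x;\bar y)$ of monadic second-order logic (MSO) with one instance variable $x$ and parameter variables $\bar y$, and for positions $\bar v$ of $B$, write $[\![\psi(x;\bar v)]\!]^B : U(B)\to\{0,1\}$ for the function that maps $u$ to $1$ iff $B\models\psi(u;\bar v)$. Let the alphabet be $\{a,b,c\}$ and let $\varphi(x;y)$ be the first-order formula $$\exists z\,\forall z'\Big(R_a(x)\wedge z<x\wedge\big((R_b(z)\wedge z<y)\vee(R_c(z)\wedge z\ge y)\big)\wedge\big(z<z'<x\to R_a(z')\big)\Big).$$ A *training sequence* over $B$ is a finite sequence of examples $(u,\lambda)\in U(B)\times\{0,1\}$; it is *$\varphi$-consistent* if some $v\in U(B)$ satisfies $\lambda=[\![\varphi(x;v)]\!]^B(u)$ for all its examples. For $q,\ell\in\mathbb N$, a *$(q,\ell)$-formula learner* is a deterministic procedure that, given a training sequence $T$ over $B$, returns a hypothesis $H_T=[\![\psi(x;\bar v')]\!]^B$ by giving an MSO formula $\psi$ of quantifier rank at most $q$ and $\bar v'\in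 U(B)^\ell$. It knows $n=|B|$ and $T$, but has only local access to the letters of $B$: in one step it may either compute internally, without restriction, or read the letter at a position that it holds in memory or at the successor or predecessor of such a position, which it then holds too; at the start it holds the positions occurring in $T$. The running time is the number of steps. The learner is *sublinear* if, for some function $f$ with $f(t,n)=o(n)$ as $n\to\infty$ for every fixed $t$, it halts within $f(t,n)$ steps on all strings of length $n$ and all $\varphi$-consistent training sequences of length $t$. For a target $g=[\![\varphi(x;v)]\!]^B$ and a probability distribution $\mathcal D$ on $U(B)$, let $\operatorname{err}_{\mathcal D}(H)=\Pr_{u\sim\mathcal D}[H(u)\ne g(u)]$, and let $T\sim\mathcal D^m$ mean that $T$ consists of $m$ positions drawn independently from $\mathcal D$ and labelled by $g$. The learner is a *PAC learning algorithm* (for $\varphi$) if for all $\varepsilon,\delta\in(0,1)$ there is an $m$ such that for every string $B$, every target $[\![\varphi(x;v)]\!]^B$ and every distribution $\mathcal D$ on $U(B)$, $\Pr_{T\sim\mathcal D^m}[\operatorname{err}_{\mathcal D}(H_T)<\varepsilon]>1-\delta$. **Theorem.** Let $q,\ell\in\mathbb N$ and let $\mathcal L$ be a sublinear $(q,\ell)$-formula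 learner. Then: 1. $\mathcal L$ is not a PAC learning algorithm for $\varphi$. 2. There are a string $B$, a target $g=[\![\varphi(x;v)]\!]^B$ and a sequence $S$ of $2\ell+3$ distinct positions of $B$ such that the hypothesis that $\mathcal L$ returns for $S$ labelled by $g$ is not consistent with this training sequence. Moreover, if $\mathcal L$ never performs worse when it sees more examples, then for the uniform distribution $\mathcal D$ on the positions in $S$ and for every number $m$ of examples $$\Pr_{T\sim\mathcal D^m}\Big[\operatorname{err}_{\mathcal D}(H_T)\ge\tfrac1{2\ell+3}\Big]=1.$$ Here "$\mathcal L$ never performs worse when it sees more examples" means: for all training sequences $T,T'$ over the same string, labelled by the same target $[\![\varphi(x;v)]\!]^B$, such that every example of $T'$ occurs in $T$, the hypothesis $H_T$ misclassifies at most as many of the distinct examples of $T$ as $H_{T'}$ does. (In particular, order and repetitions of examples do not influence the number of mistakes.) -/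

import Mathlib

namespace StringLearning

open MeasureTheory

/-- Formulas of monadic second-order logic over words with letters in `A`, with `m` free position
variables and `p` free set variables. In the scope of a quantifier, the variable with index `0` is
the one bound last. -/
inductive MSO (A : Type) : ℕ → ℕ → Type
  /-- the atom `x_i < x_j` -/
  | less {m p : ℕ} (i j : Fin m) : MSO A m p
  /-- the atom `x_i = x_j` -/
  | equal {m p : ℕ} (i j : Fin m) : MSO A m p
  /-- the atom `R_a(x_i)` -/
  | letter {m p : ℕ} (a : A) (i : Fin m) : MSO A m p
  /-- the atom `x_i ∈ X_j` -/
  | mem {m p : ℕ} (i : Fin m) (j : Fin p) : MSO A m p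
  | neg {m p : ℕ} (φ : MSO A m p) : MSO A m p
  | and {m p : ℕ} (φ ψ : MSO A m p) : MSO A m p
  /-- quantification over a position -/
  | exPos {m p : ℕ} (φ : MSO A (m + 1) p) : MSO A m p
  /-- quantification over a set of positions -/
  | exSet {m p : ℕ} (φ : MSO A m (p + 1)) : MSO A m p

namespace MSO

variable {A : Type} {m p : ℕ}

def or (φ ψ : MSO A m p) : MSO A m p := neg (and (neg φ) (neg ψ))

def imp (φ ψ : MSO A m p) : MSO A m p := or (neg φ) ψ

def allPos (φ : MSO A (m + 1) p) : MSO A m p := neg (exPos (neg φ))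

/-- The quantifier rank: the maximal number of nested quantifiers. -/
def rank {A : Type} : {m p : ℕ} → MSO A m p → ℕ
  | _, _, less _ _ => 0
  | _, _, equal _ _ => 0
  | _, _, letter _ _ => 0
  | _, _, mem _ _ => 0
  | _, _, neg φ => rank φ
  | _, _, and φ ψ => max (rank φ) (rank ψ)
  | _, _, exPos φ => rank φ + 1
  | _, _, exSet φ => rank φ + 1

/-- Satisfaction in the word `w` of length `n`, whose positions are the elements of `Fin n`. -/
def Realize {A : Type} {n : ℕ} (w : Fin n → A) :
    {m p : ℕ} → MSO A m p → (Fin m → Fin n) → (Fin p → Set (Fin n)) → Prop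
  | _, _, less i j, e, _ => e i < e j
  | _, _, equal i j, e, _ => e i = e j
  | _, _, letter a i, e, _ => w (e i) = a
  | _, _, mem i j, e, E => e i ∈ E j
  | _, _, neg φ, e, E => ¬ Realize w φ e E
  | _, _, and φ ψ, e, E => Realize w φ e E ∧ Realize w ψ e E
  | _, _, exPos φ, e, E => ∃ u : Fin n, Realize w φ (Fin.cons u e) E
  | _, _, exSet φ, e, E => ∃ S : Set (Fin n), Realize w φ e (Fin.cons S E)

open Classical in
/-- The hypothesis `⟦φ(x ; v)⟧` over the word `w`, for a formula `φ(x ; y_1, …, y_r)`: the instance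
variable `x` has index `0`, the parameter variables `y_1, …, y_r` have the indices `1, …, r`. -/
noncomputable def classify {n r : ℕ} (φ : MSO A (r + 1) 0) (w : Fin n → A)
    (v : Fin r → Fin n) (u : Fin n) : Bool :=
  decide (φ.Realize w (Fin.cons u v : Fin (r + 1) → Fin n) Fin.elim0)

/-- A training sequence over `w` is `φ`-consistent if some choice of parameters classifies all its
examples correctly. -/
def Consistent {n r : ℕ} (φ : MSO A (r + 1) 0) (w : Fin n → A) (T : List (Fin n × Bool)) : Prop :=
  ∃ v : Fin r → Fin n, ∀ e ∈ T, e.2 = φ.classify w v e.1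

end MSO

/-- What a `(q, ℓ)`-formula learner returns on a word of length `n`: a unary formula of quantifier
rank at most `q` with `ℓ` parameter variables, and values for the parameters. -/
structure Hypothesis (A : Type) (q ℓ n : ℕ) where
  formula : MSO A (ℓ + 1) 0
  rank_le : formula.rank ≤ q
  params : Fin ℓ → Fin n

/-- The classifier that the hypothesis defines over the word `w`. -/
noncomputable def Hypothesis.predict {A : Type} {q ℓ n : ℕ} (h : Hypothesis A q ℓ n)
    (w : Fin n → A) : Fin n → Bool :=
  h.formula.classify w h.params

/-- What a learner may do in one step. -/
inductive Action (A : Type) (q ℓ n : ℕ) : Type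
  /-- a step of internal computation -/
  | compute : Action A q ℓ n
  /-- ask for the letter at position `p` -/
  | access (p : Fin n) : Action A q ℓ n
  /-- stop and return `h` -/
  | halt (h : Hypothesis A q ℓ n) : Action A q ℓ n

/-- A deterministic `(q, ℓ)`-formula learner with local access to the word. At the start it knows
the length `n` of the word and the training sequence, but none of the letters. In each step its
current state determines the action, and the new state is determined by the old one and the letter
that was returned, if any. Sets of states and transition functions are arbitrary, so that all
machine models that access the word in this way are covered. -/
structure FormulaLearner (A : Type) (q ℓ : ℕ) where
  State : ℕ → Type
  start : (n : ℕ) → List (Fin n × Bool) → State n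
  action : {n : ℕ} → State n → Action A q ℓ n
  next : {n : ℕ} → State n → Option A → State n

namespace FormulaLearner

variable {A : Type} {q ℓ : ℕ}

/-- A configuration: the state, and the positions that are held in memory. -/
structure Config (L : FormulaLearner A q ℓ) (n : ℕ) where
  state : L.State n
  held : Set (Fin n)

/-- Local access: `p` is a held position, or the successor or predecessor of one. -/
def Local {n : ℕ} (held : Set (Fin n)) (p : Fin n) : Prop :=
  ∃ u ∈ held, p = u ∨ (p : ℕ) = u + 1 ∨ (u : ℕ) = p + 1

/-- At the start, the positions that occur in the training examples are held. -/
def init (L : FormulaLearner A q ℓ) {n : ℕ} (T : List (Fin n × Bool)) : L.Config n where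
  state := L.start n T
  held := {u | ∃ b, (u, b) ∈ T}

open Classical in
/-- One step on the word `w`. A request that violates local access returns no letter. -/
noncomputable def step (L : FormulaLearner A q ℓ) {n : ℕ} (w : Fin n → A) (c : L.Config n) :
    L.Config n :=
  match L.action c.state with
  | .compute => ⟨L.next c.state none, c.held⟩
  | .access p =>
      if Local c.held p then ⟨L.next c.state (some (w p)), insert p c.held⟩
      else ⟨L.next c.state none, c.held⟩
  | .halt _ => c

/-- On the word `w` and the training sequence `T` the learner returns `h` after at most `k` steps. -/
def OutputsWithin (L : FormulaLearner A q ℓ) {n : ℕ} (w : Fin n → A) (T : List (Fin n × Bool))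
    (k : ℕ) (h : Hypothesis A q ℓ n) : Prop :=
  L.action ((L.step w)^[k] (L.init T)).state = .halt h

/-- On the word `w` and the training sequence `T` the learner returns `h`. -/
def Outputs (L : FormulaLearner A q ℓ) {n : ℕ} (w : Fin n → A) (T : List (Fin n × Bool))
    (h : Hypothesis A q ℓ n) : Prop :=
  ∃ k, L.OutputsWithin w T k h

/-- The running time, on words of length `n` and `φ`-consistent training sequences of length `t`,
is at most `f t n`, where for each fixed `t` the bound `f t n` is `o(n)`. -/
def Sublinear {r : ℕ} (L : FormulaLearner A q ℓ) (φ : MSO A (r + 1) 0) : Prop :=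
  ∃ f : ℕ → ℕ → ℕ,
    (∀ t, (fun n => (f t n : ℝ)) =o[Filter.atTop] (fun n => (n : ℝ))) ∧
    ∀ (n : ℕ) (w : Fin n → A) (T : List (Fin n × Bool)), φ.Consistent w T →
      ∃ h, L.OutputsWithin w T (f T.length n) h

end FormulaLearner

/-- The training sequence with the instances `us`, labelled by the target `c`. -/
def labelled {n : ℕ} (c : Fin n → Bool) (us : List (Fin n)) : List (Fin n × Bool) :=
  us.map fun u => (u, c u)

/-- The error of the classifier `g` under the distribution `D`, for the target `c`. -/
noncomputable def err {n : ℕ} (D : Measure (Fin n)) (c g : Fin n → Bool) : ℝ :=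
  D.real {u | g u ≠ c u}

namespace FormulaLearner

variable {A : Type} {q ℓ : ℕ}

/-- The probability that, for `m` examples drawn independently from `D` and labelled by `c`, the
learner returns on the word `w` a hypothesis whose error under `D` satisfies `P`. -/
noncomputable def probErr (L : FormulaLearner A q ℓ) {n : ℕ} (w : Fin n → A) (c : Fin n → Bool)
    (D : Measure (Fin n)) (m : ℕ) (P : ℝ → Prop) : ℝ :=
  (Measure.pi fun _ : Fin m => D).real
    {us | ∃ h, L.Outputs w (labelled c (List.ofFn us)) h ∧ P (err D c (h.predict w))}

/-- The learner is a PAC learning algorithm for `φ`: for all `ε` and `δ` there is a number `m` of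
examples that suffices for every word `w`, all target parameters `v` and every distribution. -/
def IsPAC {r : ℕ} (L : FormulaLearner A q ℓ) (φ : MSO A (r + 1) 0) : Prop :=
  ∀ ε δ : ℝ, 0 < ε → ε < 1 → 0 < δ → δ < 1 → ∃ m : ℕ,
    ∀ (n : ℕ) (w : Fin n → A) (v : Fin r → Fin n) (D : Measure (Fin n)) [IsProbabilityMeasure D],
      1 - δ < L.probErr w (φ.classify w v) D m (fun x => x < ε)

/-- The learner does not perform worse if it sees more examples: if every example in `us'` occurs
in `us`, then the hypothesis returned for `us` misclassifies at most as many of the instances in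
`us` as the one returned for `us'`. As order and multiplicity do not matter for `us' ⊆ us`, this
includes that they have no influence on the quality of the returned hypothesis. -/
def NeverWorse {r : ℕ} (L : FormulaLearner A q ℓ) (φ : MSO A (r + 1) 0) : Prop :=
  ∀ (n : ℕ) (w : Fin n → A) (v : Fin r → Fin n) (us us' : List (Fin n)), us' ⊆ us →
    ∀ h h' : Hypothesis A q ℓ n,
      L.Outputs w (labelled (φ.classify w v) us) h →
      L.Outputs w (labelled (φ.classify w v) us') h' →
      (us.toFinset.filter fun u => h.predict w u ≠ φ.classify w v u).card ≤
        (us.toFinset.filter fun u => h'.predict w u ≠ φ.classify w v u).card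

end FormulaLearner

/-- The alphabet `{a, b, c}`. -/
inductive Letter : Type
  | a | b | c

/-- The quantifier-free formula
`R_a(x) ∧ z < x ∧ ((R_b(z) ∧ z < y) ∨ (R_c(z) ∧ z ≥ y)) ∧ (z < z' < x → R_a(z'))`,
where `z', z, x, y` have the indices `0, 1, 2, 3`. -/
def switchMatrix : MSO Letter 4 0 :=
  .and (.letter .a 2) <| .and (.less 1 2) <|
    .and (.or (.and (.letter .b 1) (.less 1 3)) (.and (.letter .c 1) (.neg (.less 1 3)))) <|
      .imp (.and (.less 1 0) (.less 0 2)) (.letter .a 0)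

/-- The first-order formula `φ(x ; y) = ∃ z ∀ z' ψ(z, z', x, y)` with the above matrix `ψ`. -/
def switchFormula : MSO Letter 2 0 := .exPos (.allPos switchMatrix)

end StringLearning

open StringLearning

/-!
The learner is fooled by words that are divided into `2 ℓ + 3` segments, each of which consists of
`S` blocks `x a ⋯ a`. All blocks of a segment start with the same letter, `b` or `c`, and there is
one sample position per segment, in the middle of one of its blocks. As the running time is
sublinear and the number of blocks is fixed, a learner whose examples are sample positions reads
only letters `a` if the block length `2 h` is large.

The labels of the sample positions are fixed: positive in the segments of even number, negative in
the others. For every `i`, these labels arise from a target parameter at the border between the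
segments `i` and `i + 1`, if the letters of the segments are chosen accordingly (`cutLetter`,
`classify_samplePos`). The labels `1` and `0` of the segments `2 p` and `2 p + 1`, with the
parameter in between, make both of them use the letter `b`. As the learner sees neither the letters
nor the target parameter, it returns the same hypothesis for all `p ≤ ℓ`. The `ℓ` parameters of
that hypothesis miss one of the `ℓ + 1` pairs of segments `2 p`, `2 p + 1`, and in the word that
belongs to this pair the hypothesis does not separate the two sample positions, whose labels differ
(`predict_samplePos_eq`, `exists_hard_family`).

The last point rests on a composition argument for monadic second-order types. There are finitely
many types of rank `q`, and the type of a concatenation depends only on the types of its factors.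
Hence for suitable `S = c + 1 + c'` the words `X ^ c` and `X ^ (c + S)` have the same type, and so
do `X ^ c'` and `X ^ (c' + S)`, for all blocks `X` (`exists_absorbing_power`). So, with
`Y` for the block `X` with a marked position, `X ^ c Y X ^ (c' + S)` and `X ^ (c + S) Y X ^ c'` have
the same type: marking the first or the second sample position makes no difference.

As there is a mistake on a sample position for some `p ≤ ℓ`, whatever examples are drawn from the
sample positions, a union bound over `p` refutes the PAC property for the uniform distribution on
them (`not_isPAC`). If more examples do not make the learner worse, then already the mistake for the
full sample forces a mistake for every sequence of examples drawn from it.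
-/

namespace StringLearning

/-! ### Monadic second-order types of words -/

/-- Equality of the monadic second-order `q`-types of two words over `α`, as a back-and-forth
condition. Only set moves occur: a set of positions is added to a word as a second track, which
turns it into a word over `α × Bool`, and a position is a set with one element. At rank `0` the
words have the same letters, and the same pairs of letters in order. -/
def SameType : ℕ → {α : Type} → List α → List α → Prop
  | 0, α, x, y => ∀ s : List α, s.length ≤ 2 → (s.Sublist x ↔ s.Sublist y)
  | q + 1, α, x, y =>
      (∀ X : List (α × Bool), X.map Prod.fst = x → ∃ Y : List (α × Bool), Y.map Prod.fst = y ∧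
        SameType q X Y) ∧
      (∀ Y : List (α × Bool), Y.map Prod.fst = y → ∃ X : List (α × Bool), X.map Prod.fst = x ∧
        SameType q X Y)

namespace SameType

variable {q : ℕ} {α : Type} {x y z : List α}

protected theorem refl (q : ℕ) {α : Type} (x : List α) : SameType q x x := by
  induction q generalizing α with
  | zero => exact fun _ _ => Iff.rfl
  | succ q ih => exact ⟨fun X hX => ⟨X, hX, ih X⟩, fun X hX => ⟨X, hX, ih X⟩⟩

protected theorem symm (h : SameType q x y) : SameType q y x := by
  induction q generalizing α with
  | zero => exact fun s hs => (h s hs).symm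
  | succ q ih =>
    refine ⟨fun X hX => ?_, fun X hX => ?_⟩
    · obtain ⟨Y, hY, e⟩ := h.2 X hX
      exact ⟨Y, hY, ih e⟩
    · obtain ⟨Y, hY, e⟩ := h.1 X hX
      exact ⟨Y, hY, ih e⟩

protected theorem trans (h : SameType q x y) (h' : SameType q y z) : SameType q x z := by
  induction q generalizing α with
  | zero => exact fun s hs => (h s hs).trans (h' s hs)
  | succ q ih =>
    refine ⟨fun X hX => ?_, fun Z hZ => ?_⟩
    · obtain ⟨Y, hY, e⟩ := h.1 X hX
      obtain ⟨Z, hZ, e'⟩ := h'.1 Y hY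
      exact ⟨Z, hZ, ih e e'⟩
    · obtain ⟨Y, hY, e⟩ := h'.2 Z hZ
      obtain ⟨X, hX, e'⟩ := h.2 Y hY
      exact ⟨X, hX, ih e' e⟩

/-- The composition theorem: types are compatible with concatenation. -/
protected theorem append {x' y' : List α} (h : SameType q x y) (h' : SameType q x' y') :
    SameType q (x ++ x') (y ++ y') := by
  induction q generalizing α with
  | zero =>
    have key : ∀ {x y x' y' : List α}, SameType 0 x y → SameType 0 x' y' →
        ∀ s : List α, s.length ≤ 2 → s.Sublist (x ++ x') → s.Sublist (y ++ y') := by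
      intro x y x' y' h h' s hs H
      obtain ⟨s₁, s₂, rfl, h₁, h₂⟩ := List.sublist_append_iff.1 H
      rw [List.length_append] at hs
      exact ((h s₁ (by omega)).1 h₁).append ((h' s₂ (by omega)).1 h₂)
    exact fun s hs => ⟨key h h' s hs, key h.symm h'.symm s hs⟩
  | succ q ih =>
    refine ⟨fun X hX => ?_, fun Y hY => ?_⟩
    · obtain ⟨X₁, X₂, rfl, h₁, h₂⟩ := List.map_eq_append_iff.1 hX
      obtain ⟨Y₁, hY₁, e₁⟩ := h.1 X₁ h₁
      obtain ⟨Y₂, hY₂, e₂⟩ := h'.1 X₂ h₂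
      exact ⟨Y₁ ++ Y₂, by simp [hY₁, hY₂], ih e₁ e₂⟩
    · obtain ⟨Y₁, Y₂, rfl, h₁, h₂⟩ := List.map_eq_append_iff.1 hY
      obtain ⟨X₁, hX₁, e₁⟩ := h.2 Y₁ h₁
      obtain ⟨X₂, hX₂, e₂⟩ := h'.2 Y₂ h₂
      exact ⟨X₁ ++ X₂, by simp [hX₁, hX₂], ih e₁ e₂⟩

/-- Types of any rank determine the type of rank `0`. -/
theorem rank_zero (h : SameType q x y) : SameType 0 x y := by
  induction q generalizing α with
  | zero => exact h
  | succ q ih =>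
    have key : ∀ {x y : List α} {X Y : List (α × Bool)}, X.map Prod.fst = x → Y.map Prod.fst = y →
        SameType 0 X Y → ∀ s : List α, s.length ≤ 2 → s.Sublist x → s.Sublist y := by
      rintro _ _ X Y rfl rfl e s hs H
      obtain ⟨S, hS, rfl⟩ := List.sublist_map_iff.1 H
      exact ((e S (by simpa using hs)).1 hS).map _
    -- the track is irrelevant here, and taken to be empty
    obtain ⟨Y, hY, e⟩ := h.1 (x.map fun a => (a, false)) (by simp [Function.comp_def])
    exact fun s hs => ⟨key (by simp [Function.comp_def]) hY (ih e) s hs,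
      key hY (by simp [Function.comp_def]) (ih e).symm s hs⟩

end SameType

/-- Over a finite alphabet there are only finitely many `q`-types. -/
theorem exists_finite_types (q : ℕ) (α : Type) [Finite α] :
    ∃ (T : Type) (_ : Finite T) (t : List α → T), ∀ x y, t x = t y → SameType q x y := by
  induction q generalizing α with
  | zero =>
    refine ⟨Set {s : List α // s.length ≤ 2}, ?_, fun x => {s | s.1.Sublist x}, ?_⟩
    · have : Finite {s : List α // s.length ≤ 2} := (List.finite_length_le α 2).to_subtype
      infer_instance
    · intro x y h s hs
      exact Set.ext_iff.1 h ⟨s, hs⟩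
  | succ q ih =>
    obtain ⟨T, hT, t, ht⟩ := ih (α × Bool)
    refine ⟨Set T, inferInstance, fun x => {τ | ∃ X, X.map Prod.fst = x ∧ t X = τ}, ?_⟩
    intro x y h
    refine ⟨fun X hX => ?_, fun Y hY => ?_⟩
    · obtain ⟨Y, hY, e⟩ := (Set.ext_iff.1 h (t X)).1 ⟨X, hX, rfl⟩
      exact ⟨Y, hY, ht _ _ e.symm⟩
    · obtain ⟨X, hX, e⟩ := (Set.ext_iff.1 h (t Y)).2 ⟨Y, hY, rfl⟩
      exact ⟨X, hX, ht _ _ e⟩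

/-- The power `x ^ m` of a word. -/
def wordPow {α : Type} (x : List α) (m : ℕ) : List α := (List.replicate m x).flatten

theorem wordPow_add {α : Type} (x : List α) (m k : ℕ) :
    wordPow x (m + k) = wordPow x m ++ wordPow x k := by
  simp only [wordPow, List.replicate_add, List.flatten_append]

/-- The sequence of `q`-types of the powers of a word is eventually periodic, and preperiod and
period can be chosen independently of the word. -/
theorem exists_period (q : ℕ) (α : Type) [Finite α] :
    ∃ K D : ℕ, 0 < D ∧ ∀ (x : List α) (r m : ℕ), K ≤ r →
      SameType q (wordPow x r) (wordPow x (r + D * m)) := by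
  obtain ⟨T, hT, t, ht⟩ := exists_finite_types q α
  have := Fintype.ofFinite T
  refine ⟨Fintype.card T, (Fintype.card T).factorial, Nat.factorial_pos _, fun x r m hr => ?_⟩
  obtain ⟨i, j, hij, e⟩ : ∃ i j : Fin (Fintype.card T + 1), i < j ∧
      t (wordPow x i) = t (wordPow x j) := by
    obtain ⟨i, j, hne, e⟩ := Fintype.exists_ne_map_eq_of_card_lt
      (fun i : Fin (Fintype.card T + 1) => t (wordPow x i)) (by simp)
    rcases lt_or_gt_of_ne hne with h | h
    · exact ⟨i, j, h, e⟩
    · exact ⟨j, i, h, e.symm⟩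
  have hlt : (i : ℕ) < j := hij
  -- two powers of the same type give a period `d` that depends on `x`, but divides the factorial
  obtain ⟨d, hd⟩ : ∃ d : ℕ, (j : ℕ) = i + d := ⟨j - i, by omega⟩
  have step : ∀ r, (i : ℕ) ≤ r → SameType q (wordPow x r) (wordPow x (r + d)) := by
    intro r hr
    have h₁ : wordPow x r = wordPow x i ++ wordPow x (r - i) := by
      rw [← wordPow_add]; congr 1; omega
    have h₂ : wordPow x (r + d) = wordPow x j ++ wordPow x (r - i) := by
      rw [← wordPow_add]; congr 1; omega
    rw [h₁, h₂]
    exact (ht _ _ e).append (SameType.refl q _)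
  have steps : ∀ k, SameType q (wordPow x r) (wordPow x (r + d * k)) := by
    intro k
    induction k with
    | zero => exact SameType.refl q _
    | succ k ih =>
      have := i.2
      rw [mul_add_one, ← add_assoc]
      exact ih.trans (step (r + d * k) (by omega))
  obtain ⟨k, hk⟩ : d ∣ (Fintype.card T).factorial :=
    Nat.dvd_factorial (by omega) (by have := j.2; omega)
  rw [hk, mul_assoc]
  exact steps _

/-- The words `x ^ c` and `x ^ c'` to the two sides of the `c`-th factor of `x ^ S` keep
their types when another `x ^ S` is added to them. -/
theorem exists_absorbing_power (q : ℕ) (α : Type) [Finite α] :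
    ∃ S c c' : ℕ, S = c + 1 + c' ∧ ∀ x : List α,
      SameType q (wordPow x c) (wordPow x (c + S)) ∧
      SameType q (wordPow x c') (wordPow x (c' + S)) := by
  obtain ⟨K, D, hD, h⟩ := exists_period q α
  have hKD : K ≤ K * D := Nat.le_mul_of_pos_right K hD
  refine ⟨D * (2 * K + 1), K * D, K * D + (D - 1), ?_, fun x => ⟨h x _ _ hKD, h x _ _ (by omega)⟩⟩
  obtain ⟨E, rfl⟩ : ∃ E, D = E + 1 := ⟨D - 1, by omega⟩
  simp only [Nat.add_sub_cancel]
  ring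

/-! ### Types and the satisfaction of formulas -/

/-- The word `W` over `α` describes the word `w` over `A` together with the values `e` and `E` of the
position and set variables: `lt`, `pos` and `set` read off from the letter of `W` at a position `u`
the letter of `w` at `u`, which variables have the value `u`, and which sets contain `u`. -/
structure Encodes {A α : Type} {m p n : ℕ} (lt : α → A) (pos : Fin m → α → Prop)
    (set : Fin p → α → Prop) (w : Fin n → A) (e : Fin m → Fin n) (E : Fin p → Set (Fin n))
    (W : Fin n → α) : Prop where
  letter : ∀ u, lt (W u) = w u
  pos : ∀ i u, pos i (W u) ↔ u = e i
  set : ∀ j u, set j (W u) ↔ u ∈ E j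

theorem pair_sublist_ofFn {α : Type} {n : ℕ} (W : Fin n → α) (a b : α) :
    [a, b].Sublist (List.ofFn W) ↔ ∃ i j, i < j ∧ W i = a ∧ W j = b := by
  constructor
  · intro h
    obtain ⟨f, hf⟩ := List.sublist_iff_exists_orderEmbedding_getElem?_eq.1 h
    have h0 := hf 0
    have h1 := hf 1
    have hlt : f 0 < f 1 := f.lt_iff_lt.2 zero_lt_one
    simp only [List.getElem?_cons_zero] at h0
    simp only [List.getElem?_cons_succ, List.getElem?_cons_zero] at h1
    obtain ⟨l0, e0⟩ := List.getElem?_eq_some_iff.1 h0.symm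
    obtain ⟨l1, e1⟩ := List.getElem?_eq_some_iff.1 h1.symm
    rw [List.length_ofFn] at l0 l1
    exact ⟨⟨f 0, l0⟩, ⟨f 1, l1⟩, hlt, by simpa using e0, by simpa using e1⟩
  · rintro ⟨i, j, hij, rfl, rfl⟩
    have := (List.pairwise_lt_finRange n)
    have h2 : [i, j].Sublist (List.finRange n) := by
      refine List.sublist_of_subperm_of_pairwise (r := (· < ·)) ?_ (by simpa using hij) this
      exact (List.nodup_cons.2 ⟨by simpa using hij.ne, by simp⟩).subperm (fun x _ => by simp)
    simpa [List.ofFn_eq_map] using h2.map W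

theorem singleton_sublist_ofFn {α : Type} {n : ℕ} (W : Fin n → α) (a : α) :
    [a].Sublist (List.ofFn W) ↔ ∃ i, W i = a := by
  rw [List.singleton_sublist, List.mem_ofFn']
  rfl

theorem SameType.exists_eq {q n n' : ℕ} {α : Type} {W : Fin n → α} {W' : Fin n' → α}
    (h : SameType q (List.ofFn W) (List.ofFn W')) (u : Fin n) : ∃ u', W' u' = W u :=
  (singleton_sublist_ofFn W' _).1
    ((h.rank_zero [W u] (by simp)).1 ((singleton_sublist_ofFn W _).2 ⟨u, rfl⟩))

theorem SameType.exists_lt {q n n' : ℕ} {α : Type} {W : Fin n → α} {W' : Fin n' → α}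
    (h : SameType q (List.ofFn W) (List.ofFn W')) {u v : Fin n} (huv : u < v) :
    ∃ u' v', u' < v' ∧ W' u' = W u ∧ W' v' = W v :=
  (pair_sublist_ofFn W' _ _).1
    ((h.rank_zero [W u, W v] (by simp)).1 ((pair_sublist_ofFn W _ _).2 ⟨u, v, huv, rfl, rfl⟩))

/-- A back-and-forth move that keeps the words indexed by their positions. -/
theorem SameType.move {q n n' : ℕ} {α : Type} {W : Fin n → α} {W' : Fin n' → α}
    (h : SameType (q + 1) (List.ofFn W) (List.ofFn W')) (s : Fin n → Bool) :
    ∃ s' : Fin n' → Bool,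
      SameType q (List.ofFn fun i => (W i, s i)) (List.ofFn fun i => (W' i, s' i)) := by
  obtain ⟨Y, hY, e⟩ := h.1 (List.ofFn fun i => (W i, s i))
    (by simp [List.map_ofFn, Function.comp_def])
  have hlen : Y.length = n' := by simpa using congrArg List.length hY
  subst hlen
  refine ⟨fun i => Y[i].2, ?_⟩
  have hW : ∀ i : Fin Y.length, W' i = Y[i].1 := by
    intro i
    have := congrArg (fun l => l[(i : ℕ)]?) hY
    simpa using this.symm
  have : (List.ofFn fun i => (W' i, Y[i].2)) = Y := by
    simp only [hW]
    exact List.ofFn_getElem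
  rw [this]
  exact e

/-- The position move of the back-and-forth game, as a set move with a singleton. -/
theorem Encodes.exists_move_pos {A α : Type} {m p n n' q : ℕ} {lt : α → A} {pos : Fin m → α → Prop}
    {set : Fin p → α → Prop} {w : Fin n → A} {e : Fin m → Fin n} {E : Fin p → Set (Fin n)}
    {W : Fin n → α} {w' : Fin n' → A} {e' : Fin m → Fin n'} {E' : Fin p → Set (Fin n')}
    {W' : Fin n' → α} (hW : Encodes lt pos set w e E W) (hW' : Encodes lt pos set w' e' E' W')
    (h : SameType (q + 1) (List.ofFn W) (List.ofFn W')) (u : Fin n) :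
    ∃ (u' : Fin n') (V : Fin n → α × Bool) (V' : Fin n' → α × Bool),
      Encodes (lt ∘ Prod.fst) (Fin.cons (fun a => a.2 = true) (fun i a => pos i a.1))
        (fun j a => set j a.1) w (Fin.cons u e) E V ∧
      Encodes (lt ∘ Prod.fst) (Fin.cons (fun a => a.2 = true) (fun i a => pos i a.1))
        (fun j a => set j a.1) w' (Fin.cons u' e') E' V' ∧
      SameType q (List.ofFn V) (List.ofFn V') := by
  obtain ⟨s', hs'⟩ := h.move (fun i => decide (i = u))
  obtain ⟨u', hu'⟩ := hs'.exists_eq u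
  have hu'1 : s' u' = true := by simpa using congrArg Prod.snd hu'
  -- no two positions are marked in the second word, because no two are in the first
  have key : ∀ a b, a < b → s' a = true → s' b = true → False := by
    intro a b hab ha hb
    obtain ⟨a', b', hab', h₁, h₂⟩ := hs'.symm.exists_lt hab
    have h₁ := congrArg Prod.snd h₁
    have h₂ := congrArg Prod.snd h₂
    simp only [ha, hb, decide_eq_true_eq] at h₁ h₂
    exact hab'.ne (h₁.trans h₂.symm)
  refine ⟨u', fun x => (W x, decide (x = u)), fun x => (W' x, s' x),
    ⟨fun x => hW.letter x, ?_, fun j x => hW.set j x⟩,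
    ⟨fun x => hW'.letter x, ?_, fun j x => hW'.set j x⟩, hs'⟩
  · intro i x
    cases i using Fin.cases with
    | zero => simp
    | succ i => simpa using hW.pos i x
  · intro i x
    cases i using Fin.cases with
    | zero =>
      simp only [Fin.cons_zero]
      refine ⟨fun hx => ?_, fun hx => hx ▸ hu'1⟩
      rcases lt_trichotomy x u' with hlt | heq | hlt
      · exact (key _ _ hlt hx hu'1).elim
      · exact heq
      · exact (key _ _ hlt hu'1 hx).elim
    | succ i => simpa using hW'.pos i x

open Classical in
theorem Encodes.exists_move_set {A α : Type} {m p n n' q : ℕ} {lt : α → A} {pos : Fin m → α → Prop}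
    {set : Fin p → α → Prop} {w : Fin n → A} {e : Fin m → Fin n} {E : Fin p → Set (Fin n)}
    {W : Fin n → α} {w' : Fin n' → A} {e' : Fin m → Fin n'} {E' : Fin p → Set (Fin n')}
    {W' : Fin n' → α} (hW : Encodes lt pos set w e E W) (hW' : Encodes lt pos set w' e' E' W')
    (h : SameType (q + 1) (List.ofFn W) (List.ofFn W')) (s : Set (Fin n)) :
    ∃ (s' : Set (Fin n')) (V : Fin n → α × Bool) (V' : Fin n' → α × Bool),
      Encodes (lt ∘ Prod.fst) (fun i a => pos i a.1)
        (Fin.cons (fun a => a.2 = true) (fun j a => set j a.1)) w e (Fin.cons s E) V ∧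
      Encodes (lt ∘ Prod.fst) (fun i a => pos i a.1)
        (Fin.cons (fun a => a.2 = true) (fun j a => set j a.1)) w' e' (Fin.cons s' E') V' ∧
      SameType q (List.ofFn V) (List.ofFn V') := by
  obtain ⟨s', hs'⟩ := h.move (fun i => decide (i ∈ s))
  refine ⟨{i | s' i = true}, fun x => (W x, decide (x ∈ s)), fun x => (W' x, s' x),
    ⟨fun x => hW.letter x, fun i x => hW.pos i x, ?_⟩,
    ⟨fun x => hW'.letter x, fun i x => hW'.pos i x, ?_⟩, hs'⟩
  · intro j x
    cases j using Fin.cases with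
    | zero => simp
    | succ j => simpa using hW.set j x
  · intro j x
    cases j using Fin.cases with
    | zero => simp
    | succ j => simpa using hW'.set j x

/-- One direction of `MSO.realize_iff_of_sameType`, general enough for an induction on the formula,
in which negation exchanges the two words. -/
theorem MSO.realize_of_sameType {A : Type} {m p : ℕ} (φ : MSO A m p) :
    ∀ {q : ℕ}, φ.rank ≤ q → ∀ {α : Type} {lt : α → A} {pos : Fin m → α → Prop}
      {set : Fin p → α → Prop} {n n' : ℕ} {w : Fin n → A} {e : Fin m → Fin n}
      {E : Fin p → Set (Fin n)} {W : Fin n → α} {w' : Fin n' → A} {e' : Fin m → Fin n'}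
      {E' : Fin p → Set (Fin n')} {W' : Fin n' → α},
      Encodes lt pos set w e E W → Encodes lt pos set w' e' E' W' →
      SameType q (List.ofFn W) (List.ofFn W') → φ.Realize w e E → φ.Realize w' e' E' := by
  -- For the atoms: a position of `W'` that carries the letter of `W` at the value of a variable is
  -- the value of that variable in the other word.
  induction φ with
  | less i j =>
    intro q _ α lt pos set n n' w e E W w' e' E' W' hW hW' h H
    obtain ⟨u', v', huv, hu, hv⟩ := h.exists_lt (u := e i) (v := e j) H
    have h₁ := (hW'.pos i u').1 (hu ▸ (hW.pos i (e i)).2 rfl)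
    have h₂ := (hW'.pos j v').1 (hv ▸ (hW.pos j (e j)).2 rfl)
    rw [h₁, h₂] at huv
    exact huv
  | equal i j =>
    intro q _ α lt pos set n n' w e E W w' e' E' W' hW hW' h H
    obtain ⟨u', hu⟩ := h.exists_eq (e i)
    have h₁ := (hW'.pos i u').1 (hu ▸ (hW.pos i (e i)).2 rfl)
    have h₂ := (hW'.pos j u').1 (hu ▸ (hW.pos j (e i)).2 H)
    exact h₁.symm.trans h₂
  | letter a i =>
    intro q _ α lt pos set n n' w e E W w' e' E' W' hW hW' h H
    obtain ⟨u', hu⟩ := h.exists_eq (e i)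
    have h₁ := (hW'.pos i u').1 (hu ▸ (hW.pos i (e i)).2 rfl)
    have H : w (e i) = a := H
    change w' (e' i) = a
    rw [← h₁, ← hW'.letter, hu, hW.letter, H]
  | mem i j =>
    intro q _ α lt pos set n n' w e E W w' e' E' W' hW hW' h H
    obtain ⟨u', hu⟩ := h.exists_eq (e i)
    have h₁ := (hW'.pos i u').1 (hu ▸ (hW.pos i (e i)).2 rfl)
    have h₂ := (hW'.set j u').1 (hu ▸ (hW.set j (e i)).2 H)
    rw [h₁] at h₂
    exact h₂
  | neg φ ih =>
    intro q hq α lt pos set n n' w e E W w' e' E' W' hW hW' h H H'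
    exact H (ih hq hW' hW h.symm H')
  | and φ ψ ih₁ ih₂ =>
    intro q hq α lt pos set n n' w e E W w' e' E' W' hW hW' h H
    exact ⟨ih₁ ((le_max_left _ _).trans hq) hW hW' h H.1,
      ih₂ ((le_max_right _ _).trans hq) hW hW' h H.2⟩
  | exPos φ ih =>
    rintro (_ | q) hq α lt pos set n n' w e E W w' e' E' W' hW hW' h ⟨u, H⟩
    · simp [MSO.rank] at hq
    · obtain ⟨u', V, V', hV, hV', h'⟩ := hW.exists_move_pos hW' h u
      exact ⟨u', ih (Nat.le_of_succ_le_succ hq) hV hV' h' H⟩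
  | exSet φ ih =>
    rintro (_ | q) hq α lt pos set n n' w e E W w' e' E' W' hW hW' h ⟨s, H⟩
    · simp [MSO.rank] at hq
    · obtain ⟨s', V, V', hV, hV', h'⟩ := hW.exists_move_set hW' h s
      exact ⟨s', ih (Nat.le_of_succ_le_succ hq) hV hV' h' H⟩

/-- Formulas of quantifier rank at most `q` do not distinguish encoded words of the same
`q`-type. -/
theorem MSO.realize_iff_of_sameType {A : Type} {m p : ℕ} (φ : MSO A m p) {q : ℕ}
    (hq : φ.rank ≤ q) {α : Type} {lt : α → A} {pos : Fin m → α → Prop} {set : Fin p → α → Prop}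
    {n n' : ℕ} {w : Fin n → A} {e : Fin m → Fin n} {E : Fin p → Set (Fin n)} {W : Fin n → α}
    {w' : Fin n' → A} {e' : Fin m → Fin n'} {E' : Fin p → Set (Fin n')} {W' : Fin n' → α}
    (hW : Encodes lt pos set w e E W) (hW' : Encodes lt pos set w' e' E' W')
    (h : SameType q (List.ofFn W) (List.ofFn W')) : φ.Realize w e E ↔ φ.Realize w' e' E' :=
  ⟨φ.realize_of_sameType hq hW hW' h, φ.realize_of_sameType hq hW' hW h.symm⟩


/-! ### Factors of words that consist of equal blocks -/

/-- The factor of length `l` that starts at position `s` of the infinite word `f`. -/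
def factor {α : Type} (f : ℕ → α) (s l : ℕ) : List α := (List.range l).map fun i => f (s + i)

theorem factor_add {α : Type} (f : ℕ → α) (s k l : ℕ) :
    factor f s (k + l) = factor f s k ++ factor f (s + k) l := by
  simp [factor, List.range_add, Function.comp_def, add_assoc]

theorem factor_congr {α : Type} {f g : ℕ → α} {s l : ℕ}
    (h : ∀ i, s ≤ i → i < s + l → f i = g i) : factor f s l = factor g s l := by
  refine List.map_congr_left fun i hi => h _ (by omega) ?_
  have := List.mem_range.1 hi
  omega

theorem factor_eq_wordPow {α : Type} {f : ℕ → α} {B : ℕ} {X : List α} (s m : ℕ)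
    (h : ∀ k < m, factor f (s + k * B) B = X) : factor f s (m * B) = wordPow X m := by
  induction m with
  | zero => simp [factor, wordPow]
  | succ m ih =>
    rw [add_mul, one_mul, factor_add, ih fun k hk => h k (by omega), h m (by omega), wordPow_add]
    simp [wordPow]

theorem ofFn_eq_factor {α : Type} (f : ℕ → α) (n : ℕ) :
    List.ofFn (fun i : Fin n => f i) = factor f 0 n := by
  simp [factor, List.ofFn_eq_map, ← List.map_coe_finRange_eq_range, Function.comp_def]

/-- If the words `f` and `g` consist of blocks `X` within a window of `2 S` blocks, apart from one
block `Y` at index `c` for `f` and at index `S + c` for `g`, and agree outside of that window, then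
they have the same type: the additional `X ^ S` is absorbed on the right of `Y` in `f`, and on the
left of `Y` in `g`. -/
theorem sameType_of_shifted_block {q : ℕ} {α : Type} {f g : ℕ → α} {s B S c c' n : ℕ} {X Y : List α}
    (hS : S = c + 1 + c')
    (hc : SameType q (wordPow X c) (wordPow X (c + S)))
    (hc' : SameType q (wordPow X c') (wordPow X (c' + S)))
    (hn : s + 2 * S * B ≤ n)
    (hout : ∀ i, ¬ (s ≤ i ∧ i < s + 2 * S * B) → f i = g i)
    (hf : ∀ k < 2 * S, factor f (s + k * B) B = if k = c then Y else X)
    (hg : ∀ k < 2 * S, factor g (s + k * B) B = if k = S + c then Y else X) :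
    SameType q (List.ofFn fun i : Fin n => f i) (List.ofFn fun i : Fin n => g i) := by
  have split : ∀ (f : ℕ → α) (d d' : ℕ), d + 1 + d' = 2 * S →
      (∀ k < 2 * S, factor f (s + k * B) B = if k = d then Y else X) →
      factor f s (2 * S * B) = wordPow X d ++ (Y ++ wordPow X d') := by
    intro f d d' hd hf
    have e : 2 * S * B = d * B + (B + d' * B) := by rw [← hd]; ring
    rw [e, factor_add, factor_add, factor_eq_wordPow (X := X) s d, hf d (by omega), if_pos rfl,
      factor_eq_wordPow (X := X)]
    · intro k hk
      have := hf (d + 1 + k) (by omega)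
      rw [if_neg (by omega)] at this
      rw [← this]
      congr 1
      ring
    · intro k hk
      rw [hf k (by omega), if_neg (by omega)]
  obtain ⟨r, rfl⟩ := Nat.exists_eq_add_of_le hn
  rw [ofFn_eq_factor, ofFn_eq_factor, factor_add, factor_add, factor_add, factor_add]
  have h₁ : factor f 0 s = factor g 0 s := factor_congr fun i _ hi => hout i (by omega)
  have h₂ : factor f (0 + (s + 2 * S * B)) r =
      factor g (0 + (s + 2 * S * B)) r :=
    factor_congr fun i hi _ => hout i (by omega)
  rw [h₁, h₂, zero_add, split f c (c' + S) (by omega) hf,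
    split g (c + S) c' (by omega) fun k hk => by rw [hg k hk, add_comm c]]
  exact ((SameType.refl q _).append
    (hc.append ((SameType.refl q Y).append hc'.symm))).append (SameType.refl q _)

/-! ### Words of blocks -/

/-- The infinite word whose segment of index `j` consists of `S` blocks `x_j a ⋯ a` of length
`2 h`. Finite words are its prefixes. -/
def blockWord (S h : ℕ) (x : ℕ → Letter) (p : ℕ) : Letter :=
  if p % (2 * h) = 0 then x (p / (2 * h) / S) else .a

/-- The position in the middle of the block of index `c` in segment `j`; it has distance `h` from
the closest letters `b` and `c`. -/
def samplePos (S c h j : ℕ) : ℕ := (j * S + c) * (2 * h) + h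

theorem blockWord_apply {S h : ℕ} (x : ℕ → Letter) {j r t : ℕ} (hr : r < S) (ht : t < 2 * h) :
    blockWord S h x ((j * S + r) * (2 * h) + t) = if t = 0 then x j else .a := by
  have h₁ : ((j * S + r) * (2 * h) + t) % (2 * h) = t := by
    rw [Nat.mul_add_mod', Nat.mod_eq_of_lt ht]
  have h₂ : ((j * S + r) * (2 * h) + t) / (2 * h) = j * S + r := by
    rw [mul_comm, Nat.mul_add_div (by omega), Nat.div_eq_of_lt ht, add_zero]
  have h₃ : (j * S + r) / S = j := by
    rw [mul_comm, Nat.mul_add_div (by omega), Nat.div_eq_of_lt hr, add_zero]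
  rw [blockWord, h₁, h₂, h₃]

instance : Finite Letter :=
  Finite.of_surjective (fun i : Fin 3 => ![Letter.a, Letter.b, Letter.c] i) fun x => by
    cases x
    · exact ⟨0, rfl⟩
    · exact ⟨1, rfl⟩
    · exact ⟨2, rfl⟩

/-- A hypothesis without parameters in two consecutive segments that use the same letter treats
their sample positions alike. -/
theorem predict_samplePos_eq {q ℓ S c c' h n i : ℕ} (x : ℕ → Letter) (hS : S = c + 1 + c')
    (habs : ∀ X : List (Letter × (Fin (ℓ + 1) → Bool)),
      SameType q (wordPow X c) (wordPow X (c + S)) ∧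
      SameType q (wordPow X c') (wordPow X (c' + S)))
    (hh : 0 < h) (hx : x i = x (i + 1))
    (hn : (i + 2) * S * (2 * h) ≤ n) (H : Hypothesis Letter q ℓ n)
    (hparams : ∀ k, ¬ (i * S * (2 * h) ≤ H.params k ∧
      H.params k < (i + 2) * S * (2 * h)))
    (u u' : Fin n) (hu : (u : ℕ) = samplePos S c h i)
    (hu' : (u' : ℕ) = samplePos S c h (i + 1)) :
    H.predict (fun p => blockWord S h x p) u =
      H.predict (fun p => blockWord S h x p) u' := by
  -- the word, together with the positions of the instance and the parameters
  let F : Fin n → ℕ → Letter × (Fin (ℓ + 1) → Bool) := fun u p =>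
    (blockWord S h x p, fun k => decide (((Fin.cons u H.params : Fin (ℓ + 1) → Fin n) k : ℕ) = p))
  have enc : ∀ u : Fin n, Encodes (α := Letter × (Fin (ℓ + 1) → Bool))
      (m := ℓ + 1) (p := 0) Prod.fst (fun k a => a.2 k = true)
      Fin.elim0 (fun p : Fin n => blockWord S h x p) (Fin.cons u H.params : Fin (ℓ + 1) → Fin n)
      Fin.elim0 (fun p : Fin n => F u p) := fun u =>
    ⟨fun _ => rfl, fun k p => by
      simp only [F, decide_eq_true_eq, Fin.ext_iff]
      exact eq_comm, fun j => j.elim0⟩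
  have hB : ∀ d : ℕ, i * S * (2 * h) + d * S * (2 * h) = (i + d) * S * (2 * h) := fun d => by ring
  have hwin : i * S * (2 * h) + 2 * S * (2 * h) = (i + 2) * S * (2 * h) := hB 2
  let Z : (ℕ → Bool) → List (Letter × (Fin (ℓ + 1) → Bool)) := fun mk =>
    (List.range (2 * h)).map fun t =>
      (if t = 0 then x i else .a, fun k => decide (k = 0) && mk t)
  have block : ∀ (u : Fin n) (d : ℕ), (u : ℕ) = i * S * (2 * h) + d * (2 * h) + h →
      ∀ k < 2 * S, factor (F u) (i * S * (2 * h) + k * (2 * h)) (2 * h) =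
        if k = d then Z (fun t => decide (t = h)) else Z fun _ => false := by
    intro u d hu k hk
    have : factor (F u) (i * S * (2 * h) + k * (2 * h)) (2 * h) =
        Z fun t => decide (k = d ∧ t = h) := by
      refine List.map_congr_left fun t ht => ?_
      have ht := List.mem_range.1 ht
      refine Prod.ext ?_ (funext fun y => ?_)
      · change blockWord S h x _ = _
        by_cases hkS : k < S
        · rw [show i * S * (2 * h) + k * (2 * h) + t = (i * S + k) * (2 * h) + t by ring,
            blockWord_apply x hkS ht]
        · obtain ⟨k', rfl⟩ := Nat.exists_eq_add_of_le (not_lt.1 hkS)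
          rw [show i * S * (2 * h) + (S + k') * (2 * h) + t = ((i + 1) * S + k') * (2 * h) + t by
            ring, blockWord_apply x (by omega) ht, hx]
      · have hk' : k * (2 * h) + 2 * h ≤ 2 * S * (2 * h) := by
          rw [← Nat.add_one_mul]
          exact Nat.mul_le_mul_right _ hk
        cases y using Fin.cases with
        | zero =>
          simp only [F, Fin.cons_zero, hu, decide_true, Bool.true_and, decide_eq_decide]
          constructor
          · intro e
            have hkd : k = d := by
              rcases lt_trichotomy k d with hlt | heq | hlt
              · have := Nat.mul_le_mul_right (2 * h) hlt
                rw [Nat.succ_mul] at this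
                omega
              · exact heq
              · have := Nat.mul_le_mul_right (2 * h) hlt
                rw [Nat.succ_mul] at this
                omega
            subst hkd
            exact ⟨rfl, by omega⟩
          · rintro ⟨rfl, rfl⟩
            rfl
        | succ y =>
          have := hparams y
          simp only [F, Fin.cons_succ, Fin.succ_ne_zero, decide_false, Bool.false_and,
            decide_eq_false_iff_not]
          omega
    rw [this]
    split_ifs with hkd <;> simp [hkd]
  have hsame : SameType q (List.ofFn fun p : Fin n => F u p)
      (List.ofFn fun p : Fin n => F u' p) := by
    refine sameType_of_shifted_block (s := i * S * (2 * h)) (B := 2 * h) hS (habs _).1 (habs _).2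
      (by omega) ?_ (block u c ?_) (block u' (S + c) ?_)
    · intro p hp
      refine Prod.ext rfl (funext fun y => ?_)
      have hin : ∀ j, i ≤ j → j < i + 2 → i * S * (2 * h) ≤ samplePos S c h j ∧
          samplePos S c h j < (i + 2) * S * (2 * h) := by
        intro j hj hj'
        have h₁ : i * S * (2 * h) ≤ j * S * (2 * h) := by gcongr
        have h₂ : (j + 1) * S * (2 * h) ≤ (i + 2) * S * (2 * h) := by
          have : j + 1 ≤ i + 2 := hj'
          gcongr
        have h₃ : (c + 1) * (2 * h) ≤ S * (2 * h) := by gcongr; omega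
        have h₄ : samplePos S c h j = j * S * (2 * h) + c * (2 * h) + h := by
          rw [samplePos]; ring
        have h₅ : (j + 1) * S * (2 * h) = j * S * (2 * h) + S * (2 * h) := by ring
        have h₆ : (c + 1) * (2 * h) = c * (2 * h) + 2 * h := by ring
        constructor <;> omega
      have h₀ := hin i le_rfl (by omega)
      have h₁ := hin (i + 1) (by omega) (by omega)
      cases y using Fin.cases with
      | zero =>
        simp only [F, Fin.cons_zero, hu, hu', decide_eq_decide]
        constructor <;> intro e <;> omega
      | succ y => rfl
    · rw [hu, samplePos]; ring
    · rw [hu', samplePos]; ring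
  have := H.formula.realize_iff_of_sameType H.rank_le (enc u) (enc u') hsame
  simp only [Hypothesis.predict, MSO.classify, decide_eq_decide]
  exact this

/-! ### The labels of the sample positions -/

/-- The value of the target formula at a position `u`, if `z` is the last position before `u` with a
letter different from `a`. -/
theorem classify_switchFormula {n : ℕ} (w : Fin n → Letter) (v : Fin 1 → Fin n) {z u : Fin n}
    (hzu : z < u) (hz : w z ≠ .a) (hmid : ∀ z', z < z' → z' ≤ u → w z' = .a) :
    switchFormula.classify w v u = true ↔
      (w z = .b ∧ z < v 0) ∨ (w z = .c ∧ ¬ z < v 0) := by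
  have hreal : switchFormula.Realize w (Fin.cons u v : Fin 2 → Fin n) Fin.elim0 ↔
      ∃ y, ∀ z', w u = .a ∧ y < u ∧ ((w y = .b ∧ y < v 0) ∨ (w y = .c ∧ ¬ y < v 0)) ∧
        (y < z' ∧ z' < u → w z' = .a) := by
    simp only [switchFormula, switchMatrix, MSO.allPos, MSO.imp, MSO.or, MSO.Realize]
    refine exists_congr fun y => ?_
    rw [not_exists]
    refine forall_congr' fun z' => ?_
    have e0 : (Fin.cons z' (Fin.cons y (Fin.cons u v : Fin 2 → Fin n) : Fin 3 → Fin n) :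
      Fin 4 → Fin n) 0 = z' := rfl
    have e1 : (Fin.cons z' (Fin.cons y (Fin.cons u v : Fin 2 → Fin n) : Fin 3 → Fin n) :
      Fin 4 → Fin n) 1 = y := rfl
    have e2 : (Fin.cons z' (Fin.cons y (Fin.cons u v : Fin 2 → Fin n) : Fin 3 → Fin n) :
      Fin 4 → Fin n) 2 = u := rfl
    have e3 : (Fin.cons z' (Fin.cons y (Fin.cons u v : Fin 2 → Fin n) : Fin 3 → Fin n) :
      Fin 4 → Fin n) 3 = v 0 := rfl
    simp only [Nat.reduceAdd] at *
    rw [e0, e1, e2, e3]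
    tauto
  simp only [MSO.classify, decide_eq_true_eq]
  rw [hreal]
  constructor
  · rintro ⟨y, hy⟩
    obtain ⟨-, hyu, hlet, -⟩ := hy u
    -- the witness `y` is `z`, since letters other than `a` occur at both
    have : y = z := by
      rcases lt_trichotomy y z with hlt | heq | hlt
      · exact (hz ((hy z).2.2.2 ⟨hlt, hzu⟩)).elim
      · exact heq
      · have := hmid y hlt hyu.le
        simp [this] at hlet
    rwa [← this]
  · exact fun H => ⟨z, fun z' => ⟨hmid u hzu le_rfl, hzu, H, fun hz' => hmid z' hz'.1 hz'.2.le⟩⟩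

/-- The letter of segment `j` in the word whose target parameter lies between the segments `i` and
`i + 1`. It makes the sample positions positive in segments of even number, and negative in the
others. -/
def cutLetter (i j : ℕ) : Letter := if (Even j ↔ j ≤ i) then .b else .c

/-- The labels do not depend on `i`. -/
theorem classify_samplePos {S c h i j n : ℕ} (hc : c < S) (hh : 0 < h) (v : Fin 1 → Fin n)
    (hv : (v 0 : ℕ) = (i + 1) * S * (2 * h)) (u : Fin n) (hu : (u : ℕ) = samplePos S c h j) :
    switchFormula.classify (fun p : Fin n => blockWord S h (cutLetter i) p) v u =
      decide (Even j) := by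
  have hzn : (j * S + c) * (2 * h) < n := by have := u.2; rw [hu, samplePos] at this; omega
  have hwz : blockWord S h (cutLetter i) ((j * S + c) * (2 * h)) = cutLetter i j := by
    have := blockWord_apply (cutLetter i) (j := j) hc (t := 0) (by omega : 0 < 2 * h)
    simpa using this
  have hlt : (j * S + c) * (2 * h) < (i + 1) * S * (2 * h) ↔ j ≤ i := by
    rw [Nat.mul_lt_mul_right (by omega)]
    constructor
    · intro H
      by_contra hj
      have : (i + 1) * S ≤ j * S := Nat.mul_le_mul_right _ (by omega)
      omega
    · intro H
      have : (j + 1) * S ≤ (i + 1) * S := Nat.mul_le_mul_right _ (by omega)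
      rw [Nat.succ_mul] at this
      omega
  have key := classify_switchFormula (fun p : Fin n => blockWord S h (cutLetter i) p) v
    (z := ⟨(j * S + c) * (2 * h), hzn⟩) (u := u)
    (by rw [Fin.lt_def, hu, samplePos]; simpa using hh)
    (by simp only [hwz, cutLetter]; split_ifs <;> simp)
    (by
      intro z' h₁ h₂
      rw [Fin.lt_def] at h₁
      rw [Fin.le_def, hu, samplePos] at h₂
      obtain ⟨t, ht⟩ := Nat.exists_eq_add_of_le h₁.le
      simp only at h₁ ht
      rw [ht, blockWord_apply _ hc (by omega), if_neg (by omega)])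
  simp only [Fin.lt_def, hv, hlt, hwz] at key
  rw [Bool.eq_iff_iff, key, decide_eq_true_iff, cutLetter]
  by_cases h₁ : Even j <;> by_cases h₂ : j ≤ i <;> simp [h₁, h₂]

/-! ### Runs of the learner -/

namespace FormulaLearner

variable {A : Type} {q ℓ : ℕ}

/-- A learner does not distinguish words that agree near the training examples. -/
theorem iterate_step_congr (L : FormulaLearner A q ℓ) {n : ℕ} {w w' : Fin n → A}
    {T : List (Fin n × Bool)} {k : ℕ}
    (hw : ∀ e ∈ T, ∀ p : Fin n, (p : ℕ) ≤ e.1 + k → (e.1 : ℕ) ≤ p + k → w p = w' p) (j : ℕ)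
    (hj : j ≤ k) :
    (L.step w)^[j] (L.init T) = (L.step w')^[j] (L.init T) ∧
      ∀ p ∈ ((L.step w)^[j] (L.init T)).held, ∃ e ∈ T, (p : ℕ) ≤ e.1 + j ∧ (e.1 : ℕ) ≤ p + j := by
  induction j with
  | zero =>
    refine ⟨rfl, ?_⟩
    rintro p ⟨b, hb⟩
    exact ⟨_, hb, by simp, by simp⟩
  | succ j ih =>
    obtain ⟨h₁, h₂⟩ := ih (by omega)
    rw [Function.iterate_succ_apply', Function.iterate_succ_apply', ← h₁]
    set C := (L.step w)^[j] (L.init T)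
    have weaken : ∀ p ∈ C.held, ∃ e ∈ T, (p : ℕ) ≤ e.1 + (j + 1) ∧ (e.1 : ℕ) ≤ p + (j + 1) := by
      intro p hp
      obtain ⟨e, he, h₃, h₄⟩ := h₂ p hp
      exact ⟨e, he, by omega, by omega⟩
    unfold step
    split
    · exact ⟨rfl, weaken⟩
    · next p _ =>
      split_ifs with hloc
      · have hp : ∃ e ∈ T, (p : ℕ) ≤ e.1 + (j + 1) ∧ (e.1 : ℕ) ≤ p + (j + 1) := by
          obtain ⟨u, hu, hpu⟩ := hloc
          obtain ⟨e, he, h₃, h₄⟩ := h₂ u hu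
          rcases hpu with rfl | hpu | hpu
          all_goals exact ⟨e, he, by omega, by omega⟩
        obtain ⟨e, he, h₃, h₄⟩ := hp
        refine ⟨by rw [hw e he p (by omega) (by omega)], fun p' hp' => ?_⟩
        rcases hp' with rfl | hp'
        · exact ⟨e, he, h₃, h₄⟩
        · exact weaken _ hp'
      · exact ⟨rfl, weaken⟩
    · exact ⟨rfl, weaken⟩

theorem OutputsWithin.congr {L : FormulaLearner A q ℓ} {n : ℕ} {w w' : Fin n → A}
    {T : List (Fin n × Bool)} {k : ℕ} {h : Hypothesis A q ℓ n} (H : L.OutputsWithin w T k h)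
    (hw : ∀ e ∈ T, ∀ p : Fin n, (p : ℕ) ≤ e.1 + k → (e.1 : ℕ) ≤ p + k → w p = w' p) :
    L.OutputsWithin w' T k h := by
  rw [OutputsWithin, ← (L.iterate_step_congr hw k le_rfl).1]
  exact H

theorem step_of_halt {L : FormulaLearner A q ℓ} {n : ℕ} {w : Fin n → A} {C : L.Config n}
    {h : Hypothesis A q ℓ n} (H : L.action C.state = .halt h) : L.step w C = C := by
  simp [step, H]

theorem OutputsWithin.mono {L : FormulaLearner A q ℓ} {n : ℕ} {w : Fin n → A}
    {T : List (Fin n × Bool)} {k k' : ℕ} {h : Hypothesis A q ℓ n} (H : L.OutputsWithin w T k h)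
    (hk : k ≤ k') : L.OutputsWithin w T k' h := by
  induction k', hk using Nat.le_induction with
  | base => exact H
  | succ k' _ ih =>
    rw [OutputsWithin, Function.iterate_succ_apply', step_of_halt ih]
    exact ih

theorem Outputs.unique {L : FormulaLearner A q ℓ} {n : ℕ} {w : Fin n → A}
    {T : List (Fin n × Bool)} {h h' : Hypothesis A q ℓ n} (H : L.Outputs w T h)
    (H' : L.Outputs w T h') : h = h' := by
  obtain ⟨k, hk⟩ := H
  obtain ⟨k', hk'⟩ := H'
  have h₁ := hk.mono (le_max_left k k')
  have h₂ := hk'.mono (le_max_right k k')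
  rw [OutputsWithin] at h₁ h₂
  rw [h₁] at h₂
  exact Action.halt.inj h₂

end FormulaLearner

theorem consistent_labelled {A : Type} {n r : ℕ} (φ : MSO A (r + 1) 0) (w : Fin n → A)
    (v : Fin r → Fin n) (us : List (Fin n)) : φ.Consistent w (labelled (φ.classify w v) us) := by
  refine ⟨v, fun e he => ?_⟩
  obtain ⟨u, -, rfl⟩ := List.mem_map.1 he
  rfl

/-- There are sample positions and `ℓ + 1` pairs of a word and a target that a sublinear learner
cannot tell apart by any `t` examples at the sample positions, while the hypothesis that it returns
is always wrong on one of the sample positions in one of the words. -/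
theorem exists_hard_family {q ℓ : ℕ} (L : FormulaLearner Letter q ℓ)
    (hL : L.Sublinear switchFormula) (t : ℕ) :
    ∃ (n : ℕ) (samp : Fin (2 * ℓ + 3) → Fin n) (w : Fin (ℓ + 1) → Fin n → Letter)
      (v : Fin (ℓ + 1) → Fin 1 → Fin n), Function.Injective samp ∧
      ∀ us : List (Fin n), (∀ u ∈ us, ∃ j, samp j = u) → us.length = t →
        ∃ p H j, L.Outputs (w p) (labelled (switchFormula.classify (w p) (v p)) us) H ∧
          H.predict (w p) (samp j) ≠ switchFormula.classify (w p) (v p) (samp j) := by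
  obtain ⟨S, c, c', hS, habs⟩ := exists_absorbing_power q (Letter × (Fin (ℓ + 1) → Bool))
  obtain ⟨f, hf, hrun⟩ := hL
  have hcS : c < S := by omega
  have hS0 : 0 < S := by omega
  -- the blocks are so long that the running time is smaller than half of their length
  obtain ⟨h, hh, hfh⟩ : ∃ h : ℕ, 0 < h ∧ f t ((2 * ℓ + 3) * S * (2 * h)) < h := by
    have hpos : (0 : ℝ) < 1 / (4 * (2 * ℓ + 3) * S) := by positivity
    obtain ⟨n₀, hn₀⟩ := Filter.eventually_atTop.1 ((hf t).bound hpos)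
    refine ⟨n₀ + 1, by omega, ?_⟩
    have hle : n₀ ≤ (2 * ℓ + 3) * S * (2 * (n₀ + 1)) := by
      have : 1 ≤ (2 * ℓ + 3) * S := Nat.mul_pos (by omega) hS0
      nlinarith
    have := hn₀ _ hle
    simp only [Real.norm_natCast] at this
    have hS' : (S : ℝ) ≠ 0 := by positivity
    have e : 1 / (4 * (2 * (ℓ : ℝ) + 3) * S) * (((2 * ℓ + 3) * S * (2 * (n₀ + 1)) : ℕ) : ℝ) =
        ((n₀ : ℝ) + 1) / 2 := by
      push_cast
      field_simp
      ring
    rw [e] at this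
    have h3 : (f t ((2 * ℓ + 3) * S * (2 * (n₀ + 1))) : ℝ) < ((n₀ + 1 : ℕ) : ℝ) := by
      push_cast
      have : (0 : ℝ) ≤ n₀ := by positivity
      linarith
    exact_mod_cast h3
  set n := (2 * ℓ + 3) * S * (2 * h) with hn
  have hpos_lt : ∀ j < 2 * ℓ + 3, samplePos S c h j < n := by
    intro j hj
    have h₁ : (j * S + c + 1) * (2 * h) ≤ (j + 1) * S * (2 * h) := by
      gcongr
      rw [Nat.succ_mul]
      omega
    have h₂ : (j + 1) * S * (2 * h) ≤ n :=
      Nat.mul_le_mul_right _ (Nat.mul_le_mul_right _ hj)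
    rw [samplePos]
    rw [add_mul _ 1 (2 * h)] at h₁
    omega
  have hcut_lt : ∀ p < ℓ + 1, (2 * p + 1) * S * (2 * h) < n := by
    intro p hp
    rw [hn]
    gcongr
    omega
  let samp : Fin (2 * ℓ + 3) → Fin n := fun j => ⟨samplePos S c h j, hpos_lt j j.2⟩
  let w : Fin (ℓ + 1) → Fin n → Letter := fun p u => blockWord S h (cutLetter (2 * p)) u
  let v : Fin (ℓ + 1) → Fin 1 → Fin n := fun p _ => ⟨(2 * p + 1) * S * (2 * h), hcut_lt p p.2⟩
  have hlab : ∀ p j, switchFormula.classify (w p) (v p) (samp j) = decide (Even (j : ℕ)) :=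
    fun p j => classify_samplePos hcS hh (v p) rfl (samp j) rfl
  -- what the learner can reach consists of letters `a`
  have hnear : ∀ (p : Fin (ℓ + 1)) (j : Fin (2 * ℓ + 3)) (y : Fin n) (k : ℕ), k < h →
      (y : ℕ) ≤ samp j + k → (samp j : ℕ) ≤ y + k → w p y = .a := by
    intro p j y k hk h₁ h₂
    simp only [samp, samplePos] at h₁ h₂
    obtain ⟨t, ht⟩ := Nat.exists_eq_add_of_le (show (j * S + c) * (2 * h) ≤ (y : ℕ) by omega)
    change blockWord S h _ (y : ℕ) = _
    rw [ht, blockWord_apply _ hcS (by omega), if_neg (by omega)]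
  refine ⟨n, samp, w, v, ?_, ?_⟩
  · intro j j' hjj
    have := congrArg Fin.val hjj
    simp only [samp, samplePos] at this
    have h₁ := Nat.eq_of_mul_eq_mul_right (by omega) (Nat.add_right_cancel this)
    exact Fin.ext (Nat.eq_of_mul_eq_mul_right hS0 (Nat.add_right_cancel h₁))
  · intro us hus hlen
    have hsame : ∀ p, labelled (switchFormula.classify (w p) (v p)) us =
        labelled (switchFormula.classify (w 0) (v 0)) us := by
      intro p
      refine List.map_congr_left fun u hu => ?_
      obtain ⟨j, rfl⟩ := hus u hu
      rw [hlab, hlab]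
    obtain ⟨H, hH⟩ := hrun n (w 0) _ (consistent_labelled _ (w 0) (v 0) us)
    have hlen' : (labelled (switchFormula.classify (w 0) (v 0)) us).length = t := by
      simpa [labelled] using hlen
    rw [hlen'] at hH
    -- pigeonhole: `ℓ` parameters cannot meet `ℓ + 1` disjoint pairs of segments
    obtain ⟨p, hp⟩ : ∃ p : Fin (ℓ + 1), ∀ k, ¬ ((2 * p) * S * (2 * h) ≤ H.params k ∧
        (H.params k : ℕ) < (2 * p + 2) * S * (2 * h)) := by
      by_contra! hcon
      choose k hk₁ hk₂ using hcon
      obtain ⟨a, b, hab, hkab⟩ := Fintype.exists_ne_map_eq_of_card_lt k (by simp)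
      wlog hlt : a < b generalizing a b
      · exact this b a hab.symm hkab.symm (lt_of_le_of_ne (not_lt.1 hlt) hab.symm)
      have h₁ := hk₂ a
      have h₂ := hk₁ b
      have h₃ : (2 * (a : ℕ) + 2) * S * (2 * h) ≤ 2 * b * S * (2 * h) := by
        gcongr
        have : (a : ℕ) < b := hlt
        omega
      rw [hkab] at h₁
      omega
    have hout : L.OutputsWithin (w p) (labelled (switchFormula.classify (w p) (v p)) us)
        (f t n) H := by
      rw [hsame p]
      refine hH.congr ?_
      intro e he y h₁ h₂
      obtain ⟨u, hu, rfl⟩ := List.mem_map.1 he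
      obtain ⟨j, rfl⟩ := hus u hu
      rw [hnear 0 j y _ hfh h₁ h₂, hnear p j y _ hfh h₁ h₂]
    have hp2 := p.2
    let j₀ : Fin (2 * ℓ + 3) := ⟨2 * p, by omega⟩
    let j₁ : Fin (2 * ℓ + 3) := ⟨2 * p + 1, by omega⟩
    have heq : H.predict (w p) (samp j₀) = H.predict (w p) (samp j₁) := by
      refine predict_samplePos_eq (i := 2 * p) (cutLetter (2 * p)) hS habs hh ?_ ?_ H hp _ _ rfl rfl
      · simp [cutLetter]
      · exact Nat.mul_le_mul_right _ (Nat.mul_le_mul_right _ (by omega))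
    by_cases hj₀ : H.predict (w p) (samp j₀) = switchFormula.classify (w p) (v p) (samp j₀)
    · refine ⟨p, H, j₁, ⟨_, hout⟩, ?_⟩
      rw [← heq, hj₀, hlab, hlab]
      simp [j₀, j₁]
    · exact ⟨p, H, j₀, ⟨_, hout⟩, hj₀⟩


/-! ### Errors under the uniform distribution on the sample positions -/

open MeasureTheory ProbabilityTheory

/-- A classifier that is wrong on an element of `s` has error at least `1 / |s|` under the uniform
distribution on `s`. -/
theorem one_div_le_err {n N : ℕ} (s : Finset (Fin n)) (hs : s.card = N) (c g : Fin n → Bool)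
    {u : Fin n} (hu : u ∈ s) (hne : g u ≠ c u) :
    1 / (N : ℝ) ≤ err (uniformOn (s : Set (Fin n))) c g := by
  have : IsProbabilityMeasure (uniformOn (s : Set (Fin n))) :=
    isProbabilityMeasure_uniformOn s.finite_toSet ⟨u, hu⟩
  have h₁ : (uniformOn (s : Set (Fin n))).real {u} = 1 / (N : ℝ) := by
    rw [Measure.real, ← Finset.coe_singleton, uniformOn_apply_finset,
      Finset.inter_singleton_of_mem hu, hs]
    simp
  rw [← h₁]
  exact measureReal_mono (Set.singleton_subset_iff.2 hne)

theorem pi_uniformOn_eq_one {n : ℕ} (s : Set (Fin n)) (hs : s.Nonempty) (m : ℕ) :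
    (Measure.pi fun _ : Fin m => uniformOn s) {us | ∀ i, us i ∈ s} = 1 := by
  have : IsProbabilityMeasure (uniformOn s) := isProbabilityMeasure_uniformOn s.toFinite hs
  have e : {us : Fin m → Fin n | ∀ i, us i ∈ s} = Set.univ.pi fun _ => s := by
    ext us
    simp
  rw [e, Measure.pi_pi]
  simp [uniformOn_self s.toFinite hs]

/-- The union bound over the `ℓ + 1` words of a hard family shows that in one of them the error
is at least `1 / (2 ℓ + 3)` with probability at least `1 / (ℓ + 1)`, for any number of examples. -/
theorem not_isPAC {q ℓ : ℕ} (L : FormulaLearner Letter q ℓ)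
    (hL : L.Sublinear switchFormula) : ¬ L.IsPAC switchFormula := by
  intro hPAC
  obtain ⟨m, hm⟩ := hPAC (1 / ((2 * ℓ + 3 : ℕ) : ℝ)) (1 / ((ℓ + 2 : ℕ) : ℝ)) (by positivity)
    (by rw [div_lt_one (by positivity)]; exact_mod_cast (by omega : 1 < 2 * ℓ + 3)) (by positivity)
    (by rw [div_lt_one (by positivity)]; exact_mod_cast (by omega : 1 < ℓ + 2))
  obtain ⟨n, samp, w, v, hinj, hwrong⟩ := exists_hard_family L hL m
  let s : Finset (Fin n) := Finset.univ.image samp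
  have hcard : s.card = 2 * ℓ + 3 := by
    simp [s, Finset.card_image_of_injective _ hinj]
  have hne : (s : Set (Fin n)).Nonempty := ⟨samp 0, by simp [s]⟩
  have : IsProbabilityMeasure (uniformOn (s : Set (Fin n))) :=
    isProbabilityMeasure_uniformOn s.finite_toSet hne
  set D := uniformOn (s : Set (Fin n)) with hD
  let G : Fin (ℓ + 1) → Set (Fin m → Fin n) := fun p =>
    {us | ∃ h, L.Outputs (w p) (labelled (switchFormula.classify (w p) (v p)) (List.ofFn us)) h ∧
      err D (switchFormula.classify (w p) (v p)) (h.predict (w p)) < 1 / ((2 * ℓ + 3 : ℕ) : ℝ)}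
  have hG : ∀ p, (Measure.pi fun _ : Fin m => D).real (G p)ᶜ ≤ 1 / ((ℓ + 2 : ℕ) : ℝ) := by
    intro p
    rw [probReal_compl_eq_one_sub (Set.toFinite _).measurableSet]
    have := hm n (w p) (v p) D
    change _ < (Measure.pi fun _ : Fin m => D).real (G p) at this
    linarith
  have hcover : {us : Fin m → Fin n | ∀ i, us i ∈ (s : Set (Fin n))} ⊆ ⋃ p, (G p)ᶜ := by
    intro us hus
    obtain ⟨p, H, j, hH, hj⟩ := hwrong (List.ofFn us) (by
      intro u hu
      obtain ⟨i, rfl⟩ := (List.mem_ofFn' _ _).1 hu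
      simpa [s] using hus i) (by simp)
    refine Set.mem_iUnion.2 ⟨p, ?_⟩
    rintro ⟨H', hH', herr⟩
    rw [hH'.unique hH] at herr
    exact herr.not_ge (one_div_le_err s hcard _ _ (by simp [s]) hj)
  have h₁ : (Measure.pi fun _ : Fin m => D).real (⋃ p, (G p)ᶜ) = 1 := by
    refine le_antisymm measureReal_le_one ?_
    refine le_trans (le_of_eq ?_) (measureReal_mono hcover)
    rw [Measure.real, hD, pi_uniformOn_eq_one _ hne, ENNReal.toReal_one]
  have h₂ := (measureReal_iUnion_fintype_le (μ := Measure.pi fun _ : Fin m => D)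
    fun p => (G p)ᶜ).trans (Finset.sum_le_sum fun p _ => hG p)
  rw [h₁, Finset.sum_const, Finset.card_univ, Fintype.card_fin, nsmul_eq_mul, mul_one_div,
    le_div_iff₀ (by positivity)] at h₂
  push_cast at h₂
  linarith

end StringLearning

theorem mainTheorem4 (q ℓ : ℕ) (L : FormulaLearner Letter q ℓ)
    (hL : L.Sublinear switchFormula) :
    ¬ L.IsPAC switchFormula ∧
    ∃ (n : ℕ) (w : Fin n → Letter) (v : Fin 1 → Fin n) (us : List (Fin n)),
      us.Nodup ∧ us.length = 2 * ℓ + 3 ∧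
      (∃ h, L.Outputs w (labelled (switchFormula.classify w v) us) h ∧
        ∃ u ∈ us, h.predict w u ≠ switchFormula.classify w v u) ∧
      (L.NeverWorse switchFormula → ∀ m : ℕ,
        L.probErr w (switchFormula.classify w v)
          (ProbabilityTheory.uniformOn {u | u ∈ us}) m
          (fun x => 1 / (2 * (ℓ : ℝ) + 3) ≤ x) = 1) := by
  refine ⟨not_isPAC L hL, ?_⟩
  obtain ⟨n, samp, w, v, hinj, hwrong⟩ := exists_hard_family L hL (2 * ℓ + 3)
  obtain ⟨p, H, j, hH, hj⟩ := hwrong (List.ofFn samp)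
    (fun u hu => (List.mem_ofFn' _ _).1 hu) (by simp)
  have hnodup : (List.ofFn samp).Nodup := List.nodup_ofFn.2 hinj
  have hjmem : samp j ∈ List.ofFn samp := (List.mem_ofFn' _ _).2 ⟨j, rfl⟩
  refine ⟨n, w p, v p, List.ofFn samp, hnodup, by simp, ⟨H, hH, samp j, hjmem, hj⟩, ?_⟩
  intro hworse m
  have hset : {u | u ∈ List.ofFn samp} = ((List.ofFn samp).toFinset : Set (Fin n)) := by
    ext u
    simp
  have hcard : (List.ofFn samp).toFinset.card = 2 * ℓ + 3 := by
    rw [List.toFinset_card_of_nodup hnodup, List.length_ofFn]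
  rw [hset]
  set s := (List.ofFn samp).toFinset with hs
  have hne : (s : Set (Fin n)).Nonempty := ⟨samp j, List.mem_toFinset.2 hjmem⟩
  have : MeasureTheory.IsProbabilityMeasure (ProbabilityTheory.uniformOn (s : Set (Fin n))) :=
    ProbabilityTheory.isProbabilityMeasure_uniformOn s.finite_toSet hne
  refine le_antisymm MeasureTheory.measureReal_le_one ?_
  refine le_trans (le_of_eq ?_) (MeasureTheory.measureReal_mono
    (s₁ := {us : Fin m → Fin n | ∀ i, us i ∈ (s : Set (Fin n))}) ?_)
  · rw [MeasureTheory.Measure.real, pi_uniformOn_eq_one _ hne, ENNReal.toReal_one]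
  · intro us hus
    obtain ⟨f, -, hrun⟩ := hL
    obtain ⟨H', hH'⟩ := hrun n (w p) _ (consistent_labelled _ (w p) (v p) (List.ofFn us))
    have hsub : List.ofFn us ⊆ List.ofFn samp := by
      intro u hu
      obtain ⟨i, rfl⟩ := (List.mem_ofFn' _ _).1 hu
      exact List.mem_toFinset.1 (hus i)
    -- the hypothesis for all sample positions makes a mistake, so the one for `us` does
    have hpos := (Finset.card_pos.2 ⟨samp j, Finset.mem_filter.2
      ⟨List.mem_toFinset.2 hjmem, hj⟩⟩).trans_le
      (hworse n (w p) (v p) (List.ofFn samp) (List.ofFn us) hsub H H' hH ⟨_, hH'⟩)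
    obtain ⟨u, hu⟩ := Finset.card_pos.1 hpos
    obtain ⟨hu, hune⟩ := Finset.mem_filter.1 hu
    refine ⟨H', ⟨_, hH'⟩, ?_⟩
    have := one_div_le_err s hcard (switchFormula.classify (w p) (v p)) (H'.predict (w p)) hu hune
    push_cast at this
    exact this
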